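/- Let $A$ and $B$ be groups (possibly infinite or non-commutative). Let $G=A\ast B$ be their free product and let $N$ be the kernel of the canonical surjection $A\ast B\to A\times B$. For a normal subgroup $M$ of a group $H$, let $[H,M]$ be the subgroup of $H$ generated by the $(H,M)$-commutators $[h,m]=hmh^{-1}m^{-1}$ with $h\in H$ and $m\in M$. For $x\in[H,M]$ let $\mathrm{cl}_{H,M}(x)$ be the least number $n$ such that $x$ is a product of $n$ $(H,M)$-commutators, let $\mathrm{scl}_{H,M}(x)=\lim_{n\to\infty}\mathrm{cl}_{H,M}(x^n)/n$ (this limit exists), and write $\mathrm{scl}_H=\mathrm{scl}_{H,H}$. Assume that $A$ has an element $z\neq e_A$ with $z^2=e_A$, that $\#B\geq 2$, and that $(\#A,\#B)\neq(2,2)$. Then there is $x\in[N,N]$ with $\mathrm{scl}_{G,N}(x)=0$ and $\mathrm{scl}_N(x)>0$. In particular, $\mathrm{scl}_{G,N}$ and $\mathrm{scl}_N$ are not equivalent on $[N,N]$, that is, there is no real number $C>0$ such that $C^{-1}\,\mathrm{scl}_N(x)\leq\mathrm{scl}_{G,N}(x)\leq C\,\mathrm{scl}_N(x)$ for every $x\in[N,N]$.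 -/

import Mathlib

open Filter Topology

section MixedCommutators

variable {G : Type*} [Group G]

/-- `x` is a (single) `(G,N)`-commutator: `x = [g,h] = g h g⁻¹ h⁻¹` with `g` in `G` and `h` in `N`. -/
def IsMixedCommutator (N : Subgroup G) (x : G) : Prop :=
  ∃ g : G, ∃ h ∈ N, x = g * h * g⁻¹ * h⁻¹

/-- `x` is a product of exactly `n` `(G,N)`-commutators. -/
def IsProdOfMixedCommutators (N : Subgroup G) (x : G) (n : ℕ) : Prop :=
  ∃ l : List G, l.length = n ∧ (∀ c ∈ l, IsMixedCommutator N c) ∧ l.prod = x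

/-- The `(G,N)`-commutator length: the least number of `(G,N)`-commutators with product `x`.
It is meaningful for `x` in the subgroup `⁅⊤, N⁆ = [G,N]`,
see `exists_isProdOfMixedCommutators`. -/
noncomputable def mixedCommutatorLength (N : Subgroup G) (x : G) : ℕ :=
  sInf {n : ℕ | IsProdOfMixedCommutators N x n}

/-- The stable `(G,N)`-commutator length `lim cl_{G,N}(x^n) / n`. For `N` normal and `x` in
`[G,N]` the limit exists, see `tendsto_mixedStableCommutatorLength`. -/
noncomputable def mixedStableCommutatorLength (N : Subgroup G) (x : G) : ℝ :=
  limUnder atTop (fun n : ℕ => (mixedCommutatorLength N (x ^ n) : ℝ) / n)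

/-- The stable commutator length of the group `G` itself, the case `N = G`. -/
noncomputable def stableCommutatorLength (x : G) : ℝ :=
  mixedStableCommutatorLength (⊤ : Subgroup G) x

theorem IsProdOfMixedCommutators.mul {N : Subgroup G} {x y : G} {m n : ℕ}
    (hx : IsProdOfMixedCommutators N x m) (hy : IsProdOfMixedCommutators N y n) :
    IsProdOfMixedCommutators N (x * y) (m + n) := by
  obtain ⟨l, rfl, hl, rfl⟩ := hx
  obtain ⟨k, rfl, hk, rfl⟩ := hy
  refine ⟨l ++ k, by simp, fun c hc => ?_, by simp⟩
  rcases List.mem_append.1 hc with h | h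
  exacts [hl c h, hk c h]

theorem IsMixedCommutator.inv {N : Subgroup G} [N.Normal] {x : G}
    (hx : IsMixedCommutator N x) : IsMixedCommutator N x⁻¹ := by
  obtain ⟨g, h, hh, rfl⟩ := hx
  refine ⟨g⁻¹, g * h * g⁻¹, Subgroup.Normal.conj_mem inferInstance h hh g, ?_⟩
  group

theorem exists_isProdOfMixedCommutators {N : Subgroup G} [N.Normal] {x : G}
    (hx : x ∈ ⁅(⊤ : Subgroup G), N⁆) : ∃ n, IsProdOfMixedCommutators N x n := by
  rw [Subgroup.commutator_def] at hx
  induction hx using Subgroup.closure_induction with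
  | mem x hx =>
    obtain ⟨g, -, h, hh, rfl⟩ := hx
    exact ⟨1, [g * h * g⁻¹ * h⁻¹], rfl, by simpa using ⟨g, h, hh, rfl⟩, by simp [commutatorElement_def]⟩
  | one => exact ⟨0, [], rfl, by simp, rfl⟩
  | mul x y _ _ hx hy =>
    obtain ⟨m, hm⟩ := hx
    obtain ⟨n, hn⟩ := hy
    exact ⟨m + n, hm.mul hn⟩
  | inv x _ hx =>
    obtain ⟨n, l, -, hl, rfl⟩ := hx
    refine ⟨_, (l.map fun c => c⁻¹).reverse, rfl, fun c hc => ?_, (List.prod_inv_reverse l).symm⟩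
    obtain ⟨d, hd, rfl⟩ := List.mem_map.1 (List.mem_reverse.1 hc)
    exact (hl d hd).inv

/-- The limit that defines the stable `(G,N)`-commutator length exists on `[G,N]`. -/
theorem tendsto_mixedStableCommutatorLength {N : Subgroup G} [N.Normal] {x : G}
    (hx : x ∈ ⁅(⊤ : Subgroup G), N⁆) :
    Tendsto (fun n : ℕ => (mixedCommutatorLength N (x ^ n) : ℝ) / n) atTop
      (𝓝 (mixedStableCommutatorLength N x)) := by
  have hs : Subadditive (fun n : ℕ => (mixedCommutatorLength N (x ^ n) : ℝ)) := by
    intro m n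
    have key (k : ℕ) : IsProdOfMixedCommutators N (x ^ k) (mixedCommutatorLength N (x ^ k)) :=
      Nat.sInf_mem (s := {n : ℕ | IsProdOfMixedCommutators N (x ^ k) n})
        (exists_isProdOfMixedCommutators (pow_mem hx k))
    have h := (key m).mul (key n)
    rw [← pow_add] at h
    have h2 : mixedCommutatorLength N (x ^ (m + n)) ≤
        mixedCommutatorLength N (x ^ m) + mixedCommutatorLength N (x ^ n) := Nat.sInf_le h
    dsimp only
    exact_mod_cast h2
  have hb : BddBelow (Set.range fun n : ℕ => (mixedCommutatorLength N (x ^ n) : ℝ) / n) :=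
    ⟨0, by rintro _ ⟨n, rfl⟩; positivity⟩
  exact tendsto_nhds_limUnder ⟨_, hs.tendsto_lim hb⟩

end MixedCommutators

/-- Two real functions are (bi-Lipschitzly) equivalent on the set `X`. -/
def BiLipschitzEquivalentOn {T : Type*} (X : Set T) (φ ψ : T → ℝ) : Prop :=
  ∃ C : ℝ, 0 < C ∧ ∀ x ∈ X, C⁻¹ * ψ x ≤ φ x ∧ φ x ≤ C * ψ x

/-- The kernel of the canonical surjection from the free product `A ∗ B` onto `A × B`. -/
abbrev freeProductKernel (A B : Type*) [Group A] [Group B] : Subgroup (Monoid.Coprod A B) :=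
  (Monoid.Coprod.toProd : Monoid.Coprod A B →* A × B).ker

/-!
Write `G = A ∗ B` and let `N` be the kernel of `G → A × B`. Suppose that `x ∈ [N, N]` is conjugate
to its inverse by some `z ∈ G`. Then `x ^ (2 * n) = [z, x ^ (-n)]` is a single `(G, N)`-commutator
for every `n`, so `scl_{G,N}(x) = 0`
(`mixedStableCommutatorLength_eq_zero_of_conj_eq_inv`). When `z` is an involution, every
`x = [y, z y z⁻¹]` with `y ∈ N` is of this kind. It remains to choose `y` such that `scl_N(x) > 0`.

The lower bound comes from the translation number `τ` on the group `H` of units of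
`CircleDeg1Lift`, that is, of increasing bijections of `ℝ` that commute with `t ↦ t + 1`. The
function `f ↦ f 0` is a quasimorphism on `H` at distance at most `1` from `τ`, so a homomorphism
`ψ : N → H` with `τ (ψ x) > 0` forces `scl_N(x) > 0`
(`stableCommutatorLength_pos_of_translationNumber_pos`).

Homomorphisms out of `N` are available because `N` is free on the commutators `[a, b]` with
`a ≠ 1`, `b ≠ 1`. Only the extension property is needed: any values at the `[a, b]` are taken by
some homomorphism (`exists_hom_kernelCommutator_eq`). It is obtained from an explicit action of `G`
on `(A × B) × H` that commutes with right multiplication on `H`; the kernel `N` preserves the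
fibre `{1} × H` and acts there by left multiplications. Since
`z [a, b] z⁻¹ = [z a, b] [z, b]⁻¹`, it follows that for all `u, v ∈ H` there are `ψ` and `y` with
`ψ y = u v` and `ψ (z y z⁻¹) = u⁻¹ v⁻¹` (`exists_hom_conj_involution`): if there is `a ≠ 1, z` in
`A` one takes `y = [a, b]`, and otherwise `B` has two nontrivial elements `b ≠ b'` and one takes
`y = [z, b] [z, b']`.

Finally `u, v ∈ H` are found with `τ [u v, u⁻¹ v⁻¹] = 1`
(`exists_translationNumber_commutator_eq_one`). Let `v` be the translation by `1/3` and let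
`w = u⁻¹` be a conjugate of `v`. As `v³ = w³ = c` is the central translation by `1`, the commutator
equals `(w v)³ c⁻²` up to conjugation and has translation number `3 τ(w v) - 2`. This is `1` once
`w v` has translation number `1`, for which it suffices that `w` moves `0` to `2/3`.
-/

open scoped commutatorElement

/-! ### Lower bound for the stable commutator length from translation numbers -/

/-- Evaluation at `0` is bounded on commutators: `g` and `[f, g] g` are conjugate by `f`, hence take
values at `0` that differ by less than `2`, and evaluation at `0` is additive on `[f, g] g` up to an
error less than `1`. -/
theorem abs_commutator_map_zero_lt (f g : CircleDeg1Liftˣ) :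
    |(⁅f, g⁆ : CircleDeg1Liftˣ) 0| < 3 := by
  have h : SemiconjBy (f : CircleDeg1Lift) (g : CircleDeg1Lift)
      ((⁅f, g⁆ * g : CircleDeg1Liftˣ) : CircleDeg1Lift) := by
    have : SemiconjBy f g (⁅f, g⁆ * g) := by
      rw [SemiconjBy, commutatorElement_def]; group
    exact congrArg Units.val this
  have h₁ := CircleDeg1Lift.dist_map_zero_lt_of_semiconjBy h
  have h₂ := CircleDeg1Lift.dist_map_map_zero_lt ((⁅f, g⁆ : CircleDeg1Liftˣ) : CircleDeg1Lift) g
  rw [Units.val_mul, CircleDeg1Lift.mul_apply, Real.dist_eq, abs_lt] at h₁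
  rw [Real.dist_eq, abs_lt] at h₂
  rw [abs_lt]
  constructor <;> linarith

/-- Evaluation at `0` is at most linear in the commutator length: each factor contributes less than
`3`, and each product an additivity error less than `1`. -/
theorem abs_map_zero_le_of_isProdOfMixedCommutators {f : CircleDeg1Liftˣ} {k : ℕ}
    (h : IsProdOfMixedCommutators ⊤ f k) : |f 0| ≤ 4 * k := by
  obtain ⟨l, rfl, hl, rfl⟩ := h
  induction l with
  | nil => simp
  | cons c l ih =>
    obtain ⟨a, b, -, rfl⟩ := hl c (by simp)
    have h₁ := ih fun c hc => hl c (by simp [hc])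
    have h₂ := abs_commutator_map_zero_lt a b
    have h₃ := CircleDeg1Lift.dist_map_map_zero_lt ((⁅a, b⁆ : CircleDeg1Liftˣ) : CircleDeg1Lift)
      (l.prod : CircleDeg1Liftˣ)
    rw [← commutatorElement_def, List.prod_cons, Units.val_mul, CircleDeg1Lift.mul_apply,
      List.length_cons]
    rw [Real.dist_eq, abs_lt] at h₃
    rw [abs_lt] at h₂
    rw [abs_le] at h₁ ⊢
    push_cast
    constructor <;> linarith

theorem IsProdOfMixedCommutators.map_top {G H : Type*} [Group G] [Group H] (ψ : G →* H) {x : G}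
    {k : ℕ} (h : IsProdOfMixedCommutators ⊤ x k) : IsProdOfMixedCommutators ⊤ (ψ x) k := by
  obtain ⟨l, hk, hl, rfl⟩ := h
  refine ⟨l.map ψ, by simpa using hk, fun c hc => ?_, (map_list_prod ψ l).symm⟩
  obtain ⟨d, hd, rfl⟩ := List.mem_map.1 hc
  obtain ⟨a, b, -, rfl⟩ := hl d hd
  exact ⟨ψ a, ψ b, trivial, by simp⟩

/-- A positive translation number of the image of `x` bounds the stable commutator length of `x`
away from zero; more precisely `scl x ≥ τ (ψ x) / 4`. -/
theorem stableCommutatorLength_pos_of_translationNumber_pos {G : Type*} [Group G]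
    (ψ : G →* CircleDeg1Liftˣ) {x : G} (hx : x ∈ commutator G)
    (hτ : 0 < CircleDeg1Lift.translationNumber (ψ x)) : 0 < stableCommutatorLength x := by
  set t := CircleDeg1Lift.translationNumber (ψ x) with ht
  have hlim := tendsto_mixedStableCommutatorLength (N := (⊤ : Subgroup G)) hx
  have hbound (n : ℕ) (hn : 0 < n) :
      (t - 1 / n) / 4 ≤ (mixedCommutatorLength ⊤ (x ^ n) : ℝ) / n := by
    have hk : IsProdOfMixedCommutators ⊤ (x ^ n) (mixedCommutatorLength ⊤ (x ^ n)) :=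
      Nat.sInf_mem (s := {n : ℕ | IsProdOfMixedCommutators ⊤ _ n})
        (exists_isProdOfMixedCommutators (pow_mem hx n))
    have h₁ := abs_map_zero_le_of_isProdOfMixedCommutators (hk.map_top ψ)
    have h₂ := CircleDeg1Lift.dist_map_zero_translationNumber_le (ψ (x ^ n) : CircleDeg1Lift)
    rw [map_pow, Units.val_pow_eq_pow_val, CircleDeg1Lift.translationNumber_pow, ← ht,
      Real.dist_eq, abs_le] at h₂
    rw [map_pow, Units.val_pow_eq_pow_val, abs_le] at h₁
    have hn' : (0 : ℝ) < n := by exact_mod_cast hn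
    rw [le_div_iff₀ hn', div_mul_eq_mul_div, sub_mul, one_div_mul_cancel hn'.ne']
    linarith
  have hlim' : Tendsto (fun n : ℕ => (t - 1 / n) / 4) atTop (𝓝 ((t - 0) / 4)) :=
    (tendsto_const_nhds.sub tendsto_one_div_atTop_nhds_zero_nat).div_const 4
  have := le_of_tendsto_of_tendsto hlim' hlim ((eventually_gt_atTop 0).mono hbound)
  have h4 : 0 < (t - 0) / 4 := by linarith
  exact h4.trans_le this

/-! ### Elements conjugate to their inverse -/

/-- If `z` conjugates `x` to its inverse, then each even power `x ^ (2 * n)` is the single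
`(G, N)`-commutator `[z, x ^ (-n)]`. -/
theorem mixedStableCommutatorLength_eq_zero_of_conj_eq_inv {G : Type*} [Group G] {N : Subgroup G}
    [N.Normal] {x z : G} (hx : x ∈ ⁅(⊤ : Subgroup G), N⁆) (hxN : x ∈ N)
    (hz : z * x * z⁻¹ = x⁻¹) : mixedStableCommutatorLength N x = 0 := by
  -- the limit exists, so it may be computed along the even integers
  have hlim := (tendsto_mixedStableCommutatorLength hx).comp
    (tendsto_id.const_mul_atTop' (two_pos : 0 < 2))
  refine tendsto_nhds_unique hlim ?_
  have hle (n : ℕ) : mixedCommutatorLength N (x ^ (2 * n)) ≤ 1 := by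
    refine Nat.sInf_le ⟨[x ^ (2 * n)], rfl, ?_, by simp⟩
    simp only [List.mem_singleton, forall_eq]
    refine ⟨z, (x ^ n)⁻¹, inv_mem (pow_mem hxN n), ?_⟩
    have : z * (x ^ n)⁻¹ * z⁻¹ = x ^ n := by
      rw [← conj_inv, ← conj_pow, hz, inv_pow, inv_inv]
    rw [this, inv_inv, ← pow_add, two_mul]
  have h0 : Tendsto (fun n : ℕ => (1 : ℝ) / n) atTop (𝓝 0) := tendsto_one_div_atTop_nhds_zero_nat
  refine squeeze_zero (fun n => div_nonneg (Nat.cast_nonneg _) (Nat.cast_nonneg _))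
    (fun n => ?_)
    (h0.comp (tendsto_id.const_mul_atTop' (two_pos : 0 < 2)))
  simp only [Function.comp, id]
  gcongr
  exact_mod_cast hle n

/-! ### A commutator of circle lifts with translation number one -/

/-- The periodic extension `x ↦ ⌊x⌋ + g (x - ⌊x⌋)` of a monotone self-map `g` of `[0, 1)`, as a lift
of a circle map of degree one. -/
noncomputable def circleLiftOfFundamentalDomain (g : ℝ → ℝ) (hg : MonotoneOn g (Set.Ico 0 1))
    (hm : Set.MapsTo g (Set.Ico 0 1) (Set.Ico 0 1)) : CircleDeg1Lift where
  toFun x := ⌊x⌋ + g (Int.fract x)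
  monotone' x y hxy := by
    have hx : Int.fract x ∈ Set.Ico (0 : ℝ) 1 := ⟨Int.fract_nonneg x, Int.fract_lt_one x⟩
    have hy : Int.fract y ∈ Set.Ico (0 : ℝ) 1 := ⟨Int.fract_nonneg y, Int.fract_lt_one y⟩
    rcases (Int.floor_mono hxy).eq_or_lt with h | h
    · have : g (Int.fract x) ≤ g (Int.fract y) :=
        hg hx hy (by rw [Int.fract, Int.fract, h]; linarith)
      simp only [h]
      linarith
    · have h₁ : (⌊x⌋ : ℝ) + 1 ≤ ⌊y⌋ := by exact_mod_cast h
      have h₂ := (hm hx).2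
      have h₃ := (hm hy).1
      simp only
      linarith
  map_add_one' x := by
    simp only [Int.floor_add_one, Int.fract_add_one]
    push_cast
    ring

theorem circleLiftOfFundamentalDomain_apply {g : ℝ → ℝ} (hg : MonotoneOn g (Set.Ico 0 1))
    (hm : Set.MapsTo g (Set.Ico 0 1) (Set.Ico 0 1)) {x : ℝ} (hx : x ∈ Set.Ico (0 : ℝ) 1) :
    circleLiftOfFundamentalDomain g hg hm x = g x := by
  change (⌊x⌋ : ℝ) + g (Int.fract x) = g x
  rw [Int.floor_eq_zero_iff.2 hx, Int.fract_eq_self.2 hx, Int.cast_zero, zero_add]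

theorem CircleDeg1Lift.ext_Ico {f g : CircleDeg1Lift} (h : ∀ x ∈ Set.Ico (0 : ℝ) 1, f x = g x) :
    f = g := by
  ext x
  rw [← Int.floor_add_fract x, map_int_add, map_int_add,
    h _ ⟨Int.fract_nonneg x, Int.fract_lt_one x⟩]

/-- The lift is the periodic extension of the piecewise linear homeomorphism `min (2x) ((x + 1) / 2)`
of `[0, 1]`, with inverse `max (x / 2) (2x - 1)`. -/
theorem exists_circleLift_zero_third :
    ∃ h : CircleDeg1Liftˣ, h 0 = 0 ∧ h (1 / 3) = 2 / 3 := by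
  have hm : Set.MapsTo (fun x : ℝ => min (2 * x) ((x + 1) / 2)) (Set.Ico 0 1) (Set.Ico 0 1) := by
    rintro x ⟨h₀, h₁⟩
    exact ⟨le_min (by linarith) (by linarith), (min_le_right _ _).trans_lt (by linarith)⟩
  have hm' : Set.MapsTo (fun x : ℝ => max (x / 2) (2 * x - 1)) (Set.Ico 0 1) (Set.Ico 0 1) := by
    rintro x ⟨h₀, h₁⟩
    exact ⟨le_max_of_le_left (by linarith), max_lt (by linarith) (by linarith)⟩
  have hg : Monotone (fun x : ℝ => min (2 * x) ((x + 1) / 2)) := fun x y h => by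
    dsimp only; gcongr
  have hg' : Monotone (fun x : ℝ => max (x / 2) (2 * x - 1)) := fun x y h => by
    dsimp only; gcongr
  refine ⟨⟨circleLiftOfFundamentalDomain _ (hg.monotoneOn _) hm,
    circleLiftOfFundamentalDomain _ (hg'.monotoneOn _) hm', ?_, ?_⟩, ?_, ?_⟩
  · refine CircleDeg1Lift.ext_Ico fun x hx => ?_
    rw [CircleDeg1Lift.mul_apply, circleLiftOfFundamentalDomain_apply _ _ hx,
      circleLiftOfFundamentalDomain_apply _ _ (hm' hx), CircleDeg1Lift.coe_one, id]
    grind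
  · refine CircleDeg1Lift.ext_Ico fun x hx => ?_
    rw [CircleDeg1Lift.mul_apply, circleLiftOfFundamentalDomain_apply _ _ hx,
      circleLiftOfFundamentalDomain_apply _ _ (hm hx), CircleDeg1Lift.coe_one, id]
    grind
  · rw [circleLiftOfFundamentalDomain_apply _ _ (by norm_num)]
    norm_num
  · rw [circleLiftOfFundamentalDomain_apply _ _ (by norm_num)]
    norm_num

/-- Expanded, the commutator is `w⁻¹ v w v⁻² w v w⁻¹`. When `v` and `w` have the same central cube
`c`, the substitutions `v⁻² = v c⁻¹` and `w⁻¹ = w² c⁻¹` turn it into a conjugate of `(w v)³ c⁻²`. -/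
theorem commutatorElement_eq_of_pow_three_eq {H : Type*} [Group H] {v w c : H} (hv : v ^ 3 = c)
    (hw : w ^ 3 = c) (hc : ∀ g, Commute c g) :
    ⁅w⁻¹ * v, w * v⁻¹⁆ = w * (w * v) ^ 3 * w⁻¹ * (c⁻¹) ^ 2 := by
  have hc' (g : H) : c⁻¹ * g = g * c⁻¹ := (hc g).inv_left
  have hv' : v⁻¹ * v⁻¹ = v * c⁻¹ := by rw [← hv]; group
  have hw' : w⁻¹ = w * w * c⁻¹ := by rw [← hw]; group
  calc ⁅w⁻¹ * v, w * v⁻¹⁆ = w⁻¹ * v * w * (v⁻¹ * v⁻¹) * w * v * w⁻¹ := by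
        rw [commutatorElement_def]; group
    _ = w * w * c⁻¹ * v * w * (v * c⁻¹) * w * v * w⁻¹ := by rw [hv']; nth_rw 1 [hw']
    _ = w * w * v * w * v * w * v * w⁻¹ * c⁻¹ * c⁻¹ := by simp only [mul_assoc, hc']
    _ = _ := by simp only [pow_succ, pow_zero, one_mul, mul_assoc]

theorem exists_translationNumber_commutator_eq_one : ∃ u v : CircleDeg1Liftˣ,
    CircleDeg1Lift.translationNumber (⁅u * v, u⁻¹ * v⁻¹⁆ : CircleDeg1Liftˣ) = 1 := by
  obtain ⟨h, h0, h3⟩ := exists_circleLift_zero_third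
  set v := CircleDeg1Lift.translate (Multiplicative.ofAdd (1 / 3)) with hv
  set c := CircleDeg1Lift.translate (Multiplicative.ofAdd 1) with hc
  have hcomm (g : CircleDeg1Liftˣ) : Commute c g := by
    refine Units.ext (CircleDeg1Lift.ext fun x => ?_)
    simp [hc]
  have hv3 : v ^ 3 = c := by
    rw [hv, CircleDeg1Lift.translate_pow, hc]; norm_num
  set w := h * v * h⁻¹ with hw
  have hw3 : w ^ 3 = c := by
    rw [hw, conj_pow, hv3, ← (hcomm h).eq, mul_inv_cancel_right]
  have hwv : CircleDeg1Lift.translationNumber (w * v : CircleDeg1Liftˣ) = 1 := by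
    have hi : (h⁻¹ : CircleDeg1Liftˣ) 0 = 0 := by
      conv_lhs => rw [← h0]
      exact CircleDeg1Lift.units_inv_apply_apply h 0
    -- `v` moves `-1/3` to `0`, and `w = h v h⁻¹` moves `0` to `h (1/3) = 2/3`
    have : (w * v : CircleDeg1Liftˣ) (-(1 / 3)) = -(1 / 3) + (1 : ℤ) := by
      simp only [hw, Units.val_mul, CircleDeg1Lift.mul_apply, hv, CircleDeg1Lift.translate_apply,
        add_neg_cancel, hi, add_zero, h3]
      norm_num
    simpa using CircleDeg1Lift.translationNumber_of_eq_add_int _ this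
  refine ⟨w⁻¹, v, ?_⟩
  rw [inv_inv, commutatorElement_eq_of_pow_three_eq hv3 hw3 hcomm, Units.val_mul,
    CircleDeg1Lift.translationNumber_mul_of_commute, Units.val_mul, Units.val_mul,
    CircleDeg1Lift.translationNumber_conj_eq, Units.val_pow_eq_pow_val,
    CircleDeg1Lift.translationNumber_pow, hwv, Units.val_pow_eq_pow_val,
    CircleDeg1Lift.translationNumber_pow, CircleDeg1Lift.translationNumber_units_inv, hc,
    CircleDeg1Lift.translationNumber_translate]
  · norm_num
  · exact congrArg Units.val (((hcomm _).inv_left.pow_left 2).symm.eq)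

/-! ### Homomorphisms from the kernel of `A ∗ B → A × B` -/

section FreeProductKernel

open Monoid.Coprod

variable {A B H : Type*} [Group A] [Group B] [Group H]

/-- The commutator `[a, b]` of `a ∈ A` and `b ∈ B` in the free product, as an element of the kernel
of `A ∗ B → A × B`. -/
def kernelCommutator (a : A) (b : B) : freeProductKernel A B :=
  ⟨⁅(inl a : Monoid.Coprod A B), inr b⁆, by
    simp [MonoidHom.mem_ker, commutatorElement_def]⟩

/-- The action of `A ∗ B` on `(A × B) × H` in which both factors act on `A × B` by left
multiplication, `A` leaves the coordinate in `H` fixed, and `B` changes it by left multiplication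
with the coboundary `c(a, b'b) c(a, b)⁻¹` of `c(a, b) = e(a⁻¹, b⁻¹)⁻¹`. The inverses in `c` are
chosen so that `[a, b]` moves `(1, 1)` to `(1, e(a, b))` when `e` is trivial on both axes. -/
def twistedAction (e : A → B → H) : Monoid.Coprod A B →* Equiv.Perm ((A × B) × H) :=
  lift
    { toFun := fun a =>
        { toFun := fun p => ((a * p.1.1, p.1.2), p.2)
          invFun := fun p => ((a⁻¹ * p.1.1, p.1.2), p.2)
          left_inv := fun p => by simp
          right_inv := fun p => by simp }
      map_one' := by ext p <;> simp
      map_mul' := fun a a' => by ext p <;> simp [mul_assoc] }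
    { toFun := fun b =>
        { toFun := fun p => ((p.1.1, b * p.1.2),
            (e p.1.1⁻¹ (b * p.1.2)⁻¹)⁻¹ * e p.1.1⁻¹ p.1.2⁻¹ * p.2)
          invFun := fun p => ((p.1.1, b⁻¹ * p.1.2),
            (e p.1.1⁻¹ (b⁻¹ * p.1.2)⁻¹)⁻¹ * e p.1.1⁻¹ p.1.2⁻¹ * p.2)
          left_inv := fun p => by simp [mul_assoc]
          right_inv := fun p => by simp [mul_assoc] }
      map_one' := by ext p <;> simp
      map_mul' := fun b b' => by ext p <;> simp [mul_assoc] }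

/-- The action covers left multiplication on `A × B` and commutes with right multiplication
on `H`. -/
theorem twistedAction_apply (e : A → B → H) (g : Monoid.Coprod A B) (p : A × B) (h : H) :
    twistedAction e g (p, h) = (toProd g * p, (twistedAction e g (p, 1)).2 * h) := by
  induction g using Monoid.Coprod.induction_on' generalizing p h with
  | one => simp
  | inl_mul a g ih =>
    rw [map_mul, Equiv.Perm.mul_apply, ih, Equiv.Perm.mul_apply, ih p 1]
    simp [twistedAction, Prod.ext_iff, mul_assoc]
  | inr_mul b g ih =>
    rw [map_mul, Equiv.Perm.mul_apply, ih, Equiv.Perm.mul_apply, ih p 1]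
    simp [twistedAction, Prod.ext_iff, mul_assoc]

/-- The extension property of the kernel of `A ∗ B → A × B` as a free group on the commutators
`[a, b]` with `a ≠ 1` and `b ≠ 1`: their images under a homomorphism can be prescribed freely. -/
theorem exists_hom_kernelCommutator_eq (e : A → B → H) (he : ∀ b, e 1 b = 1)
    (he' : ∀ a, e a 1 = 1) :
    ∃ ψ : freeProductKernel A B →* H, ∀ a b, ψ (kernelCommutator a b) = e a b := by
  refine ⟨MonoidHom.mk' (fun n => (twistedAction e n (1, 1)).2) fun m n => ?_, fun a b => ?_⟩
  · have hn : toProd (n : Monoid.Coprod A B) = 1 := n.2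
    rw [Subgroup.coe_mul, map_mul, Equiv.Perm.mul_apply, twistedAction_apply e n, hn, mul_one,
      mul_one, twistedAction_apply]
  · simp [kernelCommutator, commutatorElement_def, twistedAction, ← map_inv,
      he, he']

theorem conj_kernelCommutator (z : A) (a : A) (b : B) :
    (inl z : Monoid.Coprod A B) * (kernelCommutator a b : Monoid.Coprod A B) *
        (inl z : Monoid.Coprod A B)⁻¹ =
      (kernelCommutator (z * a) b * (kernelCommutator z b)⁻¹ : freeProductKernel A B) := by
  simp only [kernelCommutator, Subgroup.coe_mul, Subgroup.coe_inv, commutatorElement_def, map_mul]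
  group

theorem kernelCommutator_one_left (b : B) : kernelCommutator (1 : A) b = 1 := by
  simp [kernelCommutator, Subtype.ext_iff]

/-- An involution `z` of `A` moves some `y` in the kernel so that `y` and `z y z⁻¹` have images
`u v` and `u⁻¹ v⁻¹` for prescribed `u` and `v`. This is where `A` and `B` not both having order two
is used: in that case the kernel is cyclic. -/
theorem exists_hom_conj_involution {z : A} (hz : z ≠ 1) (hz2 : z ^ 2 = 1)
    (hB : 2 ≤ ENat.card B) (hAB : (ENat.card A, ENat.card B) ≠ (2, 2)) (u v : H) :
    ∃ (ψ : freeProductKernel A B →* H) (y y' : freeProductKernel A B),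
      (inl z : Monoid.Coprod A B) * (y : Monoid.Coprod A B) * (inl z : Monoid.Coprod A B)⁻¹ = y' ∧
        ψ y = u * v ∧ ψ y' = u⁻¹ * v⁻¹ := by
  classical
  have hzz : z * z = 1 := by rw [← sq, hz2]
  by_cases hA : ∃ a : A, a ≠ 1 ∧ a ≠ z
  · -- `y = [a, b]`, with `z y z⁻¹ = [z a, b] [z, b]⁻¹`, where `[z, b]` is sent to `1`
    obtain ⟨a, ha1, haz⟩ := hA
    obtain ⟨b, hb⟩ : ∃ b : B, b ≠ 1 := by
      have : Nontrivial B := ENat.one_lt_card_iff_nontrivial B |>.1 (lt_of_lt_of_le (by norm_num) hB)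
      exact exists_ne 1
    have hza : z * a ≠ a := by simpa using hz
    have hza1 : z * a ≠ 1 := fun h => haz (by
      rw [← mul_right_inj z, h, hzz])
    obtain ⟨ψ, hψ⟩ := exists_hom_kernelCommutator_eq (A := A) (B := B)
      (fun s t => if t = b then if s = a then u * v else if s = z * a then u⁻¹ * v⁻¹ else 1 else 1)
      (by intro t; simp [ha1.symm, hza1.symm]) (by intro s; simp [hb.symm])
    refine ⟨ψ, kernelCommutator a b, _, conj_kernelCommutator z a b, by simp [hψ], ?_⟩
    have : z ≠ z * a := by simpa using ha1
    simp [hψ, hza, haz.symm, this]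
  · -- `A = {1, z}` and `y = [z, b] [z, b']`; conjugation by `z` inverts every `[z, t]`
    push Not at hA
    have hA2 : ENat.card A = 2 := by
      have h : Nat.card A = 2 := (Nat.card_eq_two_iff' 1).2 ⟨z, hz, fun a ha => hA a ha⟩
      have : Finite A := Nat.finite_of_card_ne_zero (by simp [h])
      rw [ENat.card_eq_coe_natCard, h]; rfl
    have hB3 : 3 ≤ ENat.card B := by
      have h2 : ENat.card B ≠ 2 := fun h => hAB (by rw [hA2, h])
      have h := Order.add_one_le_of_lt (lt_of_le_of_ne hB h2.symm)
      rwa [two_add_one_eq_three] at h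
    obtain ⟨b, hb, -⟩ := ENat.exists_ne_ne_of_three_le hB3 1 1
    obtain ⟨b', hb', hbb'⟩ := ENat.exists_ne_ne_of_three_le hB3 1 b
    obtain ⟨ψ, hψ⟩ := exists_hom_kernelCommutator_eq (A := A) (B := B)
      (fun s t => if s = z then if t = b then u else if t = b' then v else 1 else 1)
      (by intro t; simp [hz.symm]) (by intro s; simp [hb.symm, hb'.symm])
    have hinv (t : B) : (inl z : Monoid.Coprod A B) * (kernelCommutator z t : Monoid.Coprod A B) *
        (inl z : Monoid.Coprod A B)⁻¹ = ((kernelCommutator z t)⁻¹ : freeProductKernel A B) := by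
      rw [conj_kernelCommutator, hzz, kernelCommutator_one_left, one_mul]
    refine ⟨ψ, kernelCommutator z b * kernelCommutator z b',
      (kernelCommutator z b)⁻¹ * (kernelCommutator z b')⁻¹, ?_, by simp [hψ, hbb'],
      by simp [hψ, hbb']⟩
    rw [Subgroup.coe_mul, ← conj_mul, hinv, hinv, Subgroup.coe_mul]

end FreeProductKernel

/-! ### Comparison of the two stable commutator lengths -/

theorem mainTheorem9 (A B : Type*) [Group A] [Group B]
    (hA : ∃ z : A, z ≠ 1 ∧ z ^ 2 = 1)
    (hB : 2 ≤ ENat.card B)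
    (hAB : (ENat.card A, ENat.card B) ≠ (2, 2)) :
    (∃ x ∈ commutator (freeProductKernel A B),
      mixedStableCommutatorLength (freeProductKernel A B) (x : Monoid.Coprod A B) = 0 ∧
      0 < stableCommutatorLength x) ∧
    ¬ BiLipschitzEquivalentOn (commutator (freeProductKernel A B) : Set (freeProductKernel A B))
      (fun x => mixedStableCommutatorLength (freeProductKernel A B) (x : Monoid.Coprod A B))
      (fun x => stableCommutatorLength x) := by
  have key : ∃ x ∈ commutator (freeProductKernel A B),
      mixedStableCommutatorLength (freeProductKernel A B) (x : Monoid.Coprod A B) = 0 ∧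
      0 < stableCommutatorLength x := by
    obtain ⟨z, hz, hz2⟩ := hA
    obtain ⟨u, v, huv⟩ := exists_translationNumber_commutator_eq_one
    obtain ⟨ψ, y, y', hy, hψ, hψ'⟩ := exists_hom_conj_involution hz hz2 hB hAB u v
    have hx : ⁅y, y'⁆ ∈ commutator (freeProductKernel A B) :=
      Subgroup.commutator_mem_commutator trivial trivial
    refine ⟨⁅y, y'⁆, hx, ?_, ?_⟩
    · refine mixedStableCommutatorLength_eq_zero_of_conj_eq_inv (z := Monoid.Coprod.inl z)
        (Subgroup.commutator_mem_commutator trivial y'.2) (SetLike.coe_mem _) ?_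
      have hz1 : (Monoid.Coprod.inl z : Monoid.Coprod A B) * Monoid.Coprod.inl z = 1 := by
        rw [← map_mul, ← sq, hz2, map_one]
      have hzi : (Monoid.Coprod.inl z : Monoid.Coprod A B)⁻¹ = Monoid.Coprod.inl z :=
        inv_eq_of_mul_eq_one_left hz1
      have hy' : Monoid.Coprod.inl z * (y' : Monoid.Coprod A B) *
          (Monoid.Coprod.inl z : Monoid.Coprod A B)⁻¹ = (y : Monoid.Coprod A B) := by
        rw [← hy, hzi, mul_assoc, mul_assoc, mul_assoc, hz1, mul_one, ← mul_assoc, hz1, one_mul]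
      change _ * ⁅(y : Monoid.Coprod A B), (y' : Monoid.Coprod A B)⁆ * _⁻¹ =
        ⁅(y : Monoid.Coprod A B), (y' : Monoid.Coprod A B)⁆⁻¹
      rw [conjugate_commutatorElement, hy, hy', commutatorElement_inv]
    · refine stableCommutatorLength_pos_of_translationNumber_pos ψ hx ?_
      rw [map_commutatorElement, hψ, hψ', huv]
      exact one_pos
  refine ⟨key, ?_⟩
  rintro ⟨C, hC, h⟩
  obtain ⟨x, hx, h0, hpos⟩ := key
  have h' := (h x hx).1
  dsimp only at h'
  rw [h0] at h'
  exact absurd h' (not_le.2 (mul_pos (inv_pos.2 hC) hpos))
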